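/- Let $G=(V,E)$ be a finite graph with $n=|V|$ vertices. *Interchange process.* Each vertex contains exactly one of $n$ balls labelled $1,\dots,n$, and $v_t(i)$ denotes the vertex containing ball $i$ at time $t$; the placement at time $0$ is arbitrary (possibly random). The edges carry independent Poisson clocks of rate $2$. Whenever the clock of an edge $e$ rings, an independent fair coin is flipped, and the balls at the endpoints of $e$ are switched if it lands heads and stay where they are otherwise. The clocks, the coins and the initial placement are independent. *Chameleon process with $b$ black balls* ($0\le b\le n-1$). Each ball is in addition coloured black, white, red or pink. At time $0$, balls $1,\dots,b$ are black, ball $b+1$ is red and all other balls are white. The balls move as in the interchange process. In addition, each time an edge $e$ rings, the following is done. (1) If the endpoints of $e$ contain a red and a white ball, respectively, both balls are recoloured pink. (2) Then, if the number of pink balls is at least the number of red balls or at least the number of white balls, a further independent fair coin is flipped, and all pink balls are recoloured red (heads) or all are recoloured white (tails). Let $\rho_t(u)$ be $1$ if the ball at vertex $u$ at time $t$ is red, $\tfrac12$ if it is pink, and $0$ otherwise. Let $z_1,\dots,z_{b+1}$ be distinct vertices, and let $t\ge 0$ be such that $\mathbf P\big(v_t(1)=z_1,\dots,v_t(b)=z_b\big)>0$.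 Put $$\mu_t(z_{b+1}\mid z_1,\dots,z_b)=\mathbf P\big(v_t(b+1)=z_{b+1}\,\big|\,v_t(1)=z_1,\dots,v_t(b)=z_b\big).$$ Then $$\mu_t(z_{b+1}\mid z_1,\dots,z_b)=\mathbf E\big(\rho_t(z_{b+1})\,\big|\,v_t(1)=z_1,\dots,v_t(b)=z_b\big).$$ -/

import Mathlib

open MeasureTheory ProbabilityTheory

noncomputable section

namespace Chameleon

/-- A placement of the `n = |V|` labelled balls on the vertices, one ball on each vertex:
`x i` is the vertex that contains ball `i`.  Balls are indexed by `Fin n`, so that the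
ball called `i + 1` in the usual numbering `1, …, n` has index `i`. -/
abbrev Placement (V : Type*) [Fintype V] : Type _ := Fin (Fintype.card V) ≃ V

instance Placement.instMeasurableSpace (V : Type*) [Fintype V] :
    MeasurableSpace (Placement V) := ⊤

/-- The four colours of balls. -/
inductive Color : Type
  | black
  | white
  | red
  | pink
  deriving DecidableEq

/-- A configuration: the position and the colour of every ball. -/
structure Config (V : Type*) [Fintype V] where
  /-- the vertex at which a ball is -/
  pos : Placement V
  /-- the colour of a ball -/
  col : Fin (Fintype.card V) → Color

section Dynamics

variable {V : Type*} [Fintype V] [DecidableEq V]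

/-- The transposition of the two endpoints of an edge. -/
def edgeSwap (e : Sym2 V) : Equiv.Perm V :=
  Sym2.lift ⟨fun u v => Equiv.swap u v, fun u v => Equiv.swap_comm u v⟩ e

/-- What the interchange process does when edge `e` rings: the balls at the endpoints of `e`
are switched if the coin lands heads (`true`), and stay where they are otherwise. -/
def interchangeStep (e : Sym2 V) (heads : Bool) (x : Placement V) : Placement V :=
  if heads then x.trans (edgeSwap e) else x

/-- The number of balls of colour `c`. -/
def numColor (c : Color) (M : Config V) : ℕ :=
  (Finset.univ.filter fun i => M.col i = c).card

open Classical in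
/-- Pinkening: if the endpoints of `e` contain a red and a white ball, respectively,
both balls are recoloured pink. -/
def pinken (e : Sym2 V) (M : Config V) : Config V :=
  if ∃ i j, M.pos i ∈ e ∧ M.pos j ∈ e ∧ M.col i = Color.red ∧ M.col j = Color.white then
    { M with col := fun i => if M.pos i ∈ e then Color.pink else M.col i }
  else M

/-- Depinking: if there are at least as many pink balls as red balls, or at least as many pink
balls as white balls, all pink balls become red (coin `true`) or all become white
(coin `false`). -/
def depink (heads : Bool) (M : Config V) : Config V :=
  if numColor Color.red M ≤ numColor Color.pink M ∨
      numColor Color.white M ≤ numColor Color.pink M then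
    { M with col := fun i =>
        if M.col i = Color.pink then (if heads then Color.red else Color.white) else M.col i }
  else M

/-- What the chameleon process does when edge `e` rings: the balls move as in the interchange
process (coin `s`), then pinkening is performed, then depinking (coin `c`). -/
def chameleonStep (e : Sym2 V) (s c : Bool) (M : Config V) : Config V :=
  depink c (pinken e { M with pos := interchangeStep e s M.pos })

/-- The starting configuration with `b` black balls: the first `b` balls are black, the next one
is red and all others are white. -/
def startConfig (b : ℕ) (x : Placement V) : Config V where
  pos := x
  col := fun i =>
    if (i : ℕ) < b then Color.black else if (i : ℕ) = b then Color.red else Color.white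

/-- The redness of vertex `u` in configuration `M`. -/
def redness (u : V) (M : Config V) : ℝ :=
  match M.col (M.pos.symm u) with
  | Color.red => 1
  | Color.pink => 1 / 2
  | _ => 0

end Dynamics

section Evolution

variable {V : Type*} [Fintype V] [DecidableEq V] (G : SimpleGraph V)

/-- A ring `(e, n)`: the `n`-th ring (counted from `0`) of the clock of edge `e`. -/
abbrev Ring : Type _ := G.edgeSet × ℕ

/-- The randomness that drives the processes: the starting placement, the time between the
`(n-1)`-st and the `n`-th ring of every edge, and, for every ring, the coin that decides about
the switch and the coin that decides about the colour in case of a depinking. -/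
structure Driving where
  /-- the starting placement -/
  start : Placement V
  /-- the waiting times of the clocks -/
  wait : Ring G → ℝ
  /-- the switching coins -/
  switchCoin : Ring G → Bool
  /-- the depinking coins -/
  depinkCoin : Ring G → Bool

/-- A fair coin. -/
def fairCoin : Measure Bool := (PMF.uniformOfFintype Bool).toMeasure

instance fairCoin.instIsProbabilityMeasure : IsProbabilityMeasure fairCoin := by
  unfold fairCoin; infer_instance

/-- The exponential distribution of rate `2`. -/
def waitLaw : Measure ℝ := expMeasure 2

instance waitLaw.instIsProbabilityMeasure : IsProbabilityMeasure waitLaw :=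
  isProbabilityMeasure_expMeasure two_pos

/-- The law of the driving randomness when the starting placement has law `ν`: everything is
independent, waiting times are exponential of rate `2` (so that the clocks of the edges are
independent Poisson processes of rate `2`), and all coins are fair. -/
def drivingLaw (ν : Measure (Placement V)) :
    Measure (Placement V × (Ring G → ℝ) × (Ring G → Bool) × (Ring G → Bool)) :=
  ν.prod ((Measure.infinitePi fun _ => waitLaw).prod
    ((Measure.infinitePi fun _ => fairCoin).prod (Measure.infinitePi fun _ => fairCoin)))

variable {G}

/-- The components of the driving randomness as a tuple. -/
def Driving.toTuple (U : Driving G) :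
    Placement V × (Ring G → ℝ) × (Ring G → Bool) × (Ring G → Bool) :=
  (U.start, U.wait, U.switchCoin, U.depinkCoin)

/-- The time of the ring `p`. -/
def Driving.ringTime (U : Driving G) (p : Ring G) : ℝ :=
  ∑ i ∈ Finset.range (p.2 + 1), U.wait (p.1, i)

/-- `l` lists the rings that occur up to time `t`, in strictly increasing order of time. -/
def Driving.IsRingList (U : Driving G) (t : ℝ) (l : List (Ring G)) : Prop :=
  l.Pairwise (fun p q => U.ringTime p < U.ringTime q) ∧ ∀ p, p ∈ l ↔ U.ringTime p ≤ t

open Classical in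
/-- The list of the rings up to time `t`, in order.  Such a list is unique if it exists, and it
exists almost surely (finitely many rings, no two at the same time); the value `[]` in the
other case concerns a null event only. -/
def Driving.ringList (U : Driving G) (t : ℝ) : List (Ring G) :=
  if h : ∃ l, U.IsRingList t l then h.choose else []

/-- The interchange process at time `t`: `interchange U t i` is the position of ball `i`. -/
def interchange (U : Driving G) (t : ℝ) : Placement V :=
  (U.ringList t).foldl (fun x p => interchangeStep (p.1 : Sym2 V) (U.switchCoin p) x) U.start

/-- The chameleon process with `b` black balls at time `t`. -/
def chameleon (b : ℕ) (U : Driving G) (t : ℝ) : Config V :=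
  (U.ringList t).foldl
    (fun M p => chameleonStep (p.1 : Sym2 V) (U.switchCoin p) (U.depinkCoin p) M)
    (startConfig b U.start)

end Evolution

end Chameleon

end

noncomputable section

namespace Chameleon

/-! Fix the starting placement and the ordered list of rings; only the coins remain random. Give
red, pink and other balls the weights 1, 1/2, 0. For a configuration whose first `b` balls are
black, the mean of the final weight of the ball at the last prescribed vertex, on the event that the
black balls are as prescribed, equals the sum over balls `j` of the initial weight of `j` times the
interchange probability that `j` and the black balls end as prescribed (`chameleonMean_redness`).

This goes by induction on the list, peeling off the first ring. Depinking preserves the mean weight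
of each ball. Pinkening changes the weights 1, 0 of two balls into 1/2, 1/2; this is harmless
because the switching coin of that same ring makes the two balls exchangeable
(`coinMean_interchangeMean_eq`).

At the start only ball `b` has positive weight, so redness minus occupation by ball `b` has mean
zero on the event (`chameleonMean_startConfig`). Fubini transfers this to the driving law, and
scaling by the inverse mass of the event gives the conditional statement. -/

/-- The redness of a colour. -/
def colorWeight : Color → ℝ
  | Color.red => 1
  | Color.pink => 1 / 2
  | _ => 0

/-- The mean of a function of a fair coin. -/
def coinMean (f : Bool → ℝ) : ℝ := (f true + f false) / 2

theorem coinMean_const (a : ℝ) : coinMean (fun _ => a) = a := by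
  simp [coinMean]

theorem coinMean_sub (f g : Bool → ℝ) :
    coinMean (fun s => f s - g s) = coinMean f - coinMean g := by
  simp only [coinMean]; ring

theorem coinMean_sum_mul {ι : Type*} (t : Finset ι) (a : ι → ℝ) (f : ι → Bool → ℝ) :
    coinMean (fun s => ∑ j ∈ t, a j * f j s) = ∑ j ∈ t, a j * coinMean (f j) := by
  simp only [coinMean]
  rw [← Finset.sum_add_distrib, Finset.sum_div]
  exact Finset.sum_congr rfl fun j _ => by ring

theorem coinMean_sum_mul_right {ι : Type*} (t : Finset ι) (a : ι → ℝ) (f : ι → Bool → ℝ) :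
    coinMean (fun s => ∑ j ∈ t, f j s * a j) = ∑ j ∈ t, coinMean (f j) * a j := by
  simpa only [mul_comm] using coinMean_sum_mul t a f

theorem mem_edgeSwap_iff {V : Type*} [DecidableEq V] (e : Sym2 V) (v : V) : edgeSwap e v ∈ e ↔ v ∈ e := by
  induction e with
  | _ a b =>
    change Equiv.swap a b v ∈ s(a, b) ↔ _
    rw [Sym2.mem_iff, Sym2.mem_iff, Equiv.swap_apply_eq_iff, Equiv.swap_apply_eq_iff]
    simp [or_comm]

/-! ### Coin averages along a fixed list of edges. -/

section Means

variable {V : Type*} [Fintype V]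

theorem redness_eq_colorWeight (u : V) (M : Config V) :
    redness u M = colorWeight (M.col (M.pos.symm u)) := by
  unfold redness colorWeight
  cases M.col (M.pos.symm u) <;> rfl

theorem depink_pos (c : Bool) (M : Config V) : (depink c M).pos = M.pos := by
  unfold depink; split_ifs <;> rfl

/-- The pink weight 1/2 is the mean of the red weight 1 and the white weight 0, and other colours
are untouched; whether depinking is triggered does not depend on the coin. -/
theorem coinMean_colorWeight_depink (M : Config V) (j : Fin (Fintype.card V)) :
    coinMean (fun c => colorWeight ((depink c M).col j)) = colorWeight (M.col j) := by
  unfold depink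
  split_ifs with h
  · cases hj : M.col j <;> simp [coinMean, colorWeight, hj]
  · exact coinMean_const _

theorem depink_col_black {c : Bool} {M : Config V} {j : Fin (Fintype.card V)}
    (h : M.col j = Color.black) : (depink c M).col j = Color.black := by
  unfold depink; split_ifs <;> simp [h]

theorem mem_pair_of_red_white {e : Sym2 V} {M : Config V} {i j k : Fin (Fintype.card V)}
    (hi : M.pos i ∈ e) (hj : M.pos j ∈ e) (hri : M.col i = Color.red)
    (hwj : M.col j = Color.white) : M.pos k ∈ e ↔ k = i ∨ k = j := by
  have hij : M.pos i ≠ M.pos j := fun h => by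
    have h' := M.pos.injective h
    subst h'
    simp [hri] at hwj
  rw [(Sym2.mem_and_mem_iff hij).1 ⟨hi, hj⟩, Sym2.mem_iff]
  simp

/-- The event that the first `b` balls are at `z 0, …, z (b - 1)` and ball `j` is at `z b`. -/
def placedAt {b : ℕ} (hb : b < Fintype.card V) (z : Fin (b + 1) → V)
    (j : Fin (Fintype.card V)) (x : Placement V) : Prop :=
  (∀ i : Fin b, x ⟨i, i.isLt.trans hb⟩ = z i.castSucc) ∧ x j = z (Fin.last b)

open Classical in
/-- The indicator function of `placedAt`. -/
def placedInd {b : ℕ} (hb : b < Fintype.card V) (z : Fin (b + 1) → V)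
    (j : Fin (Fintype.card V)) (x : Placement V) : ℝ :=
  if placedAt hb z j x then 1 else 0

theorem placedInd_swap {b : ℕ} (hb : b < Fintype.card V) (z : Fin (b + 1) → V)
    {i j : Fin (Fintype.card V)} (hi : b ≤ i) (hj : b ≤ j) (x : Placement V) :
    placedInd hb z j ((Equiv.swap i j).trans x) = placedInd hb z i x := by
  have h : ∀ k : Fin b, Equiv.swap i j ⟨k, k.isLt.trans hb⟩ = ⟨k, k.isLt.trans hb⟩ := fun k =>
    Equiv.swap_apply_of_ne_of_ne
      (fun h => by have := k.isLt; rw [← h] at hi; simp at hi; omega)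
      (fun h => by have := k.isLt; rw [← h] at hj; simp at hj; omega)
  have h' : placedAt hb z j ((Equiv.swap i j).trans x) ↔ placedAt hb z i x := by
    simp [placedAt, h]
  unfold placedInd
  by_cases h0 : placedAt hb z i x
  · rw [if_pos h0, if_pos (h'.2 h0)]
  · rw [if_neg h0, if_neg (mt h'.1 h0)]

variable [DecidableEq V]

/-- The mean of `K` at the end of the interchange process that starts at `x` and in which the
edges of `l` ring successively. -/
def interchangeMean (K : Placement V → ℝ) : List (Sym2 V) → Placement V → ℝ
  | [], x => K x
  | e :: l, x => coinMean fun s => interchangeMean K l (interchangeStep e s x)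

/-- The mean of `H` at the end of the chameleon process that starts at `M` and in which the
edges of `l` ring successively. -/
def chameleonMean (H : Config V → ℝ) : List (Sym2 V) → Config V → ℝ
  | [], M => H M
  | e :: l, M => coinMean fun s => coinMean fun c => chameleonMean H l (chameleonStep e s c M)

theorem pinken_pos (e : Sym2 V) (M : Config V) : (pinken e M).pos = M.pos := by
  unfold pinken; split_ifs <;> rfl

theorem chameleonStep_pos (e : Sym2 V) (s c : Bool) (M : Config V) :
    (chameleonStep e s c M).pos = interchangeStep e s M.pos := by
  simp [chameleonStep, depink_pos, pinken_pos]

theorem pinken_col_black {e : Sym2 V} {M : Config V} {j : Fin (Fintype.card V)}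
    (h : M.col j = Color.black) : (pinken e M).col j = Color.black := by
  unfold pinken
  split_ifs with hp
  · obtain ⟨i, k, hi, hk, hri, hwk⟩ := hp
    have : ¬ M.pos j ∈ e := by
      rw [mem_pair_of_red_white hi hk hri hwk]
      rintro (rfl | rfl) <;> simp_all
    simp [this, h]
  · exact h

theorem chameleonStep_col_black {e : Sym2 V} {s c : Bool} {M : Config V}
    {j : Fin (Fintype.card V)} (h : M.col j = Color.black) :
    (chameleonStep e s c M).col j = Color.black :=
  depink_col_black (pinken_col_black h)

theorem interchangeStep_mem_iff (e : Sym2 V) (s : Bool) (x : Placement V)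
    (j : Fin (Fintype.card V)) : interchangeStep e s x j ∈ e ↔ x j ∈ e := by
  cases s
  · rfl
  · exact mem_edgeSwap_iff e (x j)

theorem interchangeStep_relabel (τ : Equiv.Perm (Fin (Fintype.card V))) (e : Sym2 V) (s : Bool)
    (x : Placement V) : interchangeStep e s (τ.trans x) = τ.trans (interchangeStep e s x) := by
  cases s <;> rfl

/-- Relabelling balls is precomposition and the dynamics is postcomposition, so the two commute. -/
theorem interchangeMean_relabel (τ : Equiv.Perm (Fin (Fintype.card V))) (K : Placement V → ℝ)
    (l : List (Sym2 V)) (x : Placement V) :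
    interchangeMean K l (τ.trans x) = interchangeMean (fun y => K (τ.trans y)) l x := by
  induction l generalizing x with
  | nil => rfl
  | cons e l ih => simp only [interchangeMean, interchangeStep_relabel, ih]

/-- Swapping the two balls at the endpoints of `e` is the same as moving them along `e`. -/
theorem swap_trans_eq {e : Sym2 V} {x : Placement V} {i j : Fin (Fintype.card V)} (hij : i ≠ j)
    (hi : x i ∈ e) (hj : x j ∈ e) : (Equiv.swap i j).trans x = x.trans (edgeSwap e) := by
  rw [(Sym2.mem_and_mem_iff (x.injective.ne hij)).1 ⟨hi, hj⟩]
  change _ = x.trans (Equiv.swap (x i) (x j))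
  ext k
  simp only [Equiv.trans_apply, Equiv.swap_apply_def, x.injective.eq_iff]
  split_ifs <;> simp

/-- When the edge between two balls that are not black rings, the two balls become
exchangeable. -/
theorem coinMean_interchangeMean_eq {b : ℕ} (hb : b < Fintype.card V) (z : Fin (b + 1) → V)
    {e : Sym2 V} {x : Placement V} {i j : Fin (Fintype.card V)} (hij : i ≠ j)
    (hi : b ≤ i) (hj : b ≤ j) (hxi : x i ∈ e) (hxj : x j ∈ e) (l : List (Sym2 V)) :
    (coinMean fun s => interchangeMean (placedInd hb z i) l (interchangeStep e s x)) =
      coinMean fun s => interchangeMean (placedInd hb z j) l (interchangeStep e s x) := by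
  have key : ∀ y, interchangeMean (placedInd hb z i) l y =
      interchangeMean (placedInd hb z j) l ((Equiv.swap i j).trans y) := fun y => by
    rw [interchangeMean_relabel]
    simp only [placedInd_swap hb z hi hj]
  -- The relabelled start is the start moved along `e`, so relabelling just exchanges the two
  -- outcomes of the switching coin.
  simp only [key, ← interchangeStep_relabel, swap_trans_eq hij hxi hxj]
  have h2 : (x.trans (edgeSwap e)).trans (edgeSwap e) = x := by
    rw [← swap_trans_eq hij hxi hxj]
    rw [← swap_trans_eq hij (by simpa using hxj) (by simpa using hxi)]
    ext k; simp
  simp [coinMean, interchangeStep, h2, add_comm]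

/-- Only the recoloured pair matters: 1 + 0 = 1/2 + 1/2, with equal coefficients. Both balls have
labels at least `b` because they are not black. -/
theorem sum_colorWeight_pinken {b : ℕ} (M : Config V)
    (hM : ∀ i : Fin (Fintype.card V), (i : ℕ) < b → M.col i = Color.black) (e : Sym2 V)
    (a : Fin (Fintype.card V) → ℝ)
    (ha : ∀ i j : Fin (Fintype.card V), i ≠ j → b ≤ (i : ℕ) → b ≤ (j : ℕ) → M.pos i ∈ e → M.pos j ∈ e → a i = a j) :
    ∑ j, colorWeight ((pinken e M).col j) * a j = ∑ j, colorWeight (M.col j) * a j := by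
  unfold pinken
  split_ifs with hp
  · obtain ⟨i, j, hi, hj, hri, hwj⟩ := hp
    have hij : i ≠ j := by rintro rfl; simp [hri] at hwj
    have hbi : b ≤ (i : ℕ) := by
      by_contra h; simp [hM i (by omega)] at hri
    have hbj : b ≤ (j : ℕ) := by
      by_contra h; simp [hM j (by omega)] at hwj
    rw [← Finset.add_sum_erase _ _ (Finset.mem_univ i),
      ← Finset.add_sum_erase _ _ (Finset.mem_univ i),
      ← Finset.add_sum_erase _ _ (Finset.mem_erase.2 ⟨hij.symm, Finset.mem_univ j⟩),
      ← Finset.add_sum_erase _ _ (Finset.mem_erase.2 ⟨hij.symm, Finset.mem_univ j⟩),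
      ← add_assoc, ← add_assoc]
    congr 1
    · simp [hi, hj, hri, hwj, colorWeight, ha i j hij hbi hbj hi hj]
      ring
    · refine Finset.sum_congr rfl fun k hk => ?_
      simp only [Finset.mem_erase] at hk
      have : ¬ M.pos k ∈ e := by
        rw [mem_pair_of_red_white hi hj hri hwj]
        tauto
      simp [this]
  · rfl

/-- The mean redness of the last vertex, on the event that the black balls are at the prescribed
vertices, in terms of the interchange process. -/
theorem chameleonMean_redness {b : ℕ} (hb : b < Fintype.card V) (z : Fin (b + 1) → V)
    (l : List (Sym2 V)) (M : Config V)
    (hM : ∀ i : Fin (Fintype.card V), (i : ℕ) < b → M.col i = Color.black) :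
    chameleonMean (fun M => ∑ j, colorWeight (M.col j) * placedInd hb z j M.pos) l M =
      ∑ j, colorWeight (M.col j) * interchangeMean (placedInd hb z j) l M.pos := by
  induction l generalizing M with
  | nil => rfl
  | cons e l ih =>
    have h1 : ∀ s c, chameleonMean (fun M => ∑ j, colorWeight (M.col j) * placedInd hb z j M.pos) l
        (chameleonStep e s c M) = ∑ j, colorWeight ((chameleonStep e s c M).col j) *
          interchangeMean (placedInd hb z j) l (interchangeStep e s M.pos) := fun s c => by
      rw [ih _ fun i hi => chameleonStep_col_black (hM i hi), chameleonStep_pos]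
    -- A switch along `e` keeps the set of balls at the endpoints, so the pinkened colours do not
    -- depend on `s` and the average over `s` acts on the placement factor alone.
    have hcol : ∀ s j, (pinken e { M with pos := interchangeStep e s M.pos }).col j =
        (pinken e M).col j := fun s j => by
      unfold pinken
      simp only [interchangeStep_mem_iff]
      split_ifs <;> rfl
    simp only [chameleonMean, h1, coinMean_sum_mul_right, interchangeMean]
    simp only [chameleonStep, coinMean_colorWeight_depink, hcol, coinMean_sum_mul]
    exact sum_colorWeight_pinken M hM e _ fun i j hij hi hj hxi hxj =>
      coinMean_interchangeMean_eq hb z hij hi hj hxi hxj l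

theorem chameleonMean_pos (K : Placement V → ℝ) (l : List (Sym2 V)) (M : Config V) :
    chameleonMean (fun M => K M.pos) l M = interchangeMean K l M.pos := by
  induction l generalizing M with
  | nil => rfl
  | cons e l ih =>
    simp only [chameleonMean, interchangeMean, ih, chameleonStep_pos, coinMean_const]

theorem chameleonMean_sub (H H' : Config V → ℝ) (l : List (Sym2 V)) (M : Config V) :
    chameleonMean (fun M => H M - H' M) l M = chameleonMean H l M - chameleonMean H' l M := by
  induction l generalizing M with
  | nil => rfl
  | cons e l ih => simp only [chameleonMean, ih, coinMean_sub]

open Classical in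
theorem sum_colorWeight_mul_placedInd {b : ℕ} (hb : b < Fintype.card V) (z : Fin (b + 1) → V)
    (M : Config V) : ∑ j, colorWeight (M.col j) * placedInd hb z j M.pos =
      if ∀ i : Fin b, M.pos ⟨i, i.isLt.trans hb⟩ = z i.castSucc then
        redness (z (Fin.last b)) M else 0 := by
  rw [redness_eq_colorWeight]
  split_ifs with h
  · rw [Finset.sum_eq_single (M.pos.symm (z (Fin.last b)))]
    · simp [placedInd, placedAt, h]
    · intro j _ hj
      have : M.pos j ≠ z (Fin.last b) := fun h' => hj (by simp [← h'])
      simp [placedInd, placedAt, this]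
    · simp
  · exact Finset.sum_eq_zero fun j _ => by simp [placedInd, placedAt, h]

/-- The mean of redness minus occupation by ball `b`, on the event that the black balls are at the
prescribed vertices, vanishes. -/
theorem chameleonMean_startConfig {b : ℕ} (hb : b < Fintype.card V) (z : Fin (b + 1) → V)
    (l : List (Sym2 V)) (x : Placement V) :
    chameleonMean (fun M => ∑ j, colorWeight (M.col j) * placedInd hb z j M.pos -
      placedInd hb z ⟨b, hb⟩ M.pos) l (startConfig b x) = 0 := by
  rw [chameleonMean_sub, chameleonMean_redness hb z l (startConfig b x)
    (fun i hi => by simp [startConfig, hi]), chameleonMean_pos, sub_eq_zero,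
    Finset.sum_eq_single ⟨b, hb⟩]
  · simp [startConfig, colorWeight]
  · intro j _ hj
    have : (j : ℕ) ≠ b := fun h => hj (Fin.ext h)
    by_cases h : (j : ℕ) < b <;> simp [startConfig, colorWeight, h, this]
  · simp

end Means

/-! ### Resampling one coin of an infinite family. -/

section Coins

variable {ι : Type*} [DecidableEq ι]

theorem integral_fairCoin (f : Bool → ℝ) : ∫ s, f s ∂fairCoin = coinMean f := by
  have h : ∀ s : Bool, fairCoin.real {s} = 2⁻¹ := fun s => by
    simp [fairCoin, Measure.real]
  rw [integral_fintype (Integrable.of_finite)]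
  simp [h, coinMean]
  ring

theorem integral_coinMean {α : Type*} [MeasurableSpace α] {μ : Measure α} {g : Bool → α → ℝ}
    (hg : ∀ c, Integrable (g c) μ) :
    ∫ w, coinMean (fun c => g c w) ∂μ = coinMean fun c => ∫ w, g c w ∂μ := by
  simp only [coinMean]
  rw [integral_div, integral_add (hg _) (hg _)]

/-- Resampling one coordinate preserves an infinite product measure. -/
theorem measurePreserving_update {X : Type*} [MeasurableSpace X] (μ : Measure X)
    [IsProbabilityMeasure μ] (p : ι) :
    MeasurePreserving (fun q : (ι → X) × X => Function.update q.1 p q.2)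
      ((Measure.infinitePi fun _ : ι => μ).prod μ) (Measure.infinitePi fun _ : ι => μ) := by
  have hm : Measurable (fun q : (ι → X) × X => Function.update q.1 p q.2) := by
    refine measurable_pi_lambda _ fun i => ?_
    by_cases h : i = p
    · subst h; simpa using measurable_snd
    · simp only [ne_eq, h, not_false_eq_true, Function.update_of_ne]
      fun_prop
  refine ⟨hm, Measure.eq_infinitePi _ fun s t ht => ?_⟩
  rw [Measure.map_apply hm (.pi s.countable_toSet fun i _ => ht i)]
  -- The constraint at `p`, if any, passes from the family to the fresh sample.
  have key : (fun q : (ι → X) × X => Function.update q.1 p q.2) ⁻¹' Set.pi s t =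
      Set.pi (s.erase p : Finset ι) t ×ˢ (if p ∈ s then t p else Set.univ) := by
    ext ⟨w, a⟩
    simp only [Set.mem_preimage, Set.mem_pi, Finset.mem_coe, Set.mem_prod, Finset.mem_erase]
    constructor
    · refine fun h => ⟨fun i hi => by simpa [hi.1] using h i hi.2, ?_⟩
      split_ifs with hp
      · simpa using h p hp
      · trivial
    · rintro ⟨h1, h2⟩ i hi
      by_cases hip : i = p
      · subst hip; simpa [hi] using h2
      · simpa [hip] using h1 i ⟨hip, hi⟩
  rw [key, Measure.prod_prod, Measure.infinitePi_pi _ fun i _ => ht i]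
  split_ifs with hp
  · rw [mul_comm, Finset.mul_prod_erase s (fun i => μ (t i)) hp]
  · simp [Finset.erase_eq_of_notMem hp]

theorem integral_infinitePi_update (p : ι) (f : (ι → Bool) → ℝ) (hf : Measurable f) {C : ℝ}
    (hC : ∀ w, |f w| ≤ C) :
    ∫ w, f w ∂(Measure.infinitePi fun _ : ι => fairCoin) =
      coinMean fun s => ∫ w, f (Function.update w p s) ∂(Measure.infinitePi fun _ : ι => fairCoin) := by
  have hp := measurePreserving_update fairCoin p
  have hint : Integrable (fun q : (ι → Bool) × Bool => f (Function.update q.1 p q.2))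
      ((Measure.infinitePi fun _ : ι => fairCoin).prod fairCoin) :=
    .of_bound (hf.comp hp.measurable).aestronglyMeasurable C (.of_forall fun q => hC _)
  rw [← integral_fairCoin, ← integral_prod_symm _ hint,
    ← integral_map hp.measurable.aemeasurable hf.aestronglyMeasurable, hp.map_eq]

end Coins

/-! ### Coin averages as integrals over all coins. -/

section Law

variable {V : Type*} [Fintype V] [DecidableEq V] {G : SimpleGraph V}

/-- The chameleon process along a list of rings. -/
def runRings (l : List (Ring G)) (q : (Ring G → Bool) × (Ring G → Bool)) (M : Config V) :
    Config V :=
  l.foldl (fun M p => chameleonStep (p.1 : Sym2 V) (q.1 p) (q.2 p) M) M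

theorem runRings_cons (p : Ring G) (l : List (Ring G)) (q : (Ring G → Bool) × (Ring G → Bool))
    (M : Config V) : runRings (p :: l) q M =
      runRings l q (chameleonStep (p.1 : Sym2 V) (q.1 p) (q.2 p) M) := rfl

theorem measurable_runRings (H : Config V → ℝ) (l : List (Ring G)) (M : Config V) :
    Measurable fun q => H (runRings l q M) := by
  induction l generalizing M with
  | nil =>
    simp only [runRings, List.foldl_nil]
    exact measurable_const
  | cons p l ih =>
    -- The two coins of the first ring become a separate countable parameter, so that the induction
    -- hypothesis sees a deterministic configuration.
    have h : Measurable fun r : (Bool × Bool) × ((Ring G → Bool) × (Ring G → Bool)) =>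
        H (runRings l r.2 (chameleonStep (p.1 : Sym2 V) r.1.1 r.1.2 M)) :=
      measurable_from_prod_countable_right fun sc => ih (chameleonStep (p.1 : Sym2 V) sc.1 sc.2 M)
    have h' : Measurable fun q : (Ring G → Bool) × (Ring G → Bool) => ((q.1 p, q.2 p), q) := by
      fun_prop
    simp only [runRings_cons]
    have hcomp := h.comp h'
    simp only [Function.comp_def] at hcomp
    exact hcomp

open Classical in
theorem runRings_update {l : List (Ring G)} {p : Ring G} (hp : p ∉ l)
    (q : (Ring G → Bool) × (Ring G → Bool)) (s c : Bool) (M : Config V) :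
    runRings l (Function.update q.1 p s, Function.update q.2 p c) M = runRings l q M := by
  induction l generalizing M with
  | nil => rfl
  | cons r l ih =>
    simp only [List.mem_cons, not_or] at hp
    simp only [runRings, List.foldl_cons] at ih ⊢
    rw [ih hp.2, Function.update_of_ne (Ne.symm hp.1), Function.update_of_ne (Ne.symm hp.1)]

/-- Since no ring repeats, the coins of the first ring are not read again and can be resampled and
averaged separately. -/
theorem integral_runRings (H : Config V → ℝ) {C : ℝ} (hC : ∀ M, |H M| ≤ C) {l : List (Ring G)}
    (hl : l.Nodup) (M : Config V) :
    ∫ q, H (runRings l q M) ∂((Measure.infinitePi fun _ : Ring G => fairCoin).prod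
      (Measure.infinitePi fun _ : Ring G => fairCoin)) =
      chameleonMean H (l.map fun p => (p.1 : Sym2 V)) M := by
  classical
  have hint : ∀ (l : List (Ring G)) (M : Config V), Integrable (fun q => H (runRings l q M))
      ((Measure.infinitePi fun _ : Ring G => fairCoin).prod
        (Measure.infinitePi fun _ : Ring G => fairCoin)) := fun l M =>
    .of_bound (measurable_runRings H l M).aestronglyMeasurable C (.of_forall fun _ => hC _)
  induction l generalizing M with
  | nil => simp [runRings, chameleonMean]
  | cons p l ih =>
    rw [List.nodup_cons] at hl
    simp only [List.map_cons, chameleonMean, ← ih hl.2]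
    have hm := measurable_runRings H (p :: l) M
    have hstep : ∀ q s c, runRings (p :: l) (Function.update q.1 p s, Function.update q.2 p c) M =
        runRings l q (chameleonStep (p.1 : Sym2 V) s c M) := fun q s c => by
      rw [← runRings_update hl.1 q s c]
      simp [runRings]
    rw [integral_prod _ (hint _ _), integral_infinitePi_update p _
      (hm.stronglyMeasurable.integral_prod_right).measurable (C := C) fun w => by
        refine (norm_integral_le_of_norm_le_const (C := C)
          (f := fun w' => H (runRings (p :: l) (w, w') M)) (.of_forall fun w' => hC _)).trans ?_
        simp]
    congr 1
    funext s
    have hinner : ∀ w : Ring G → Bool, ∫ w', H (runRings (p :: l) (Function.update w p s, w') M)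
        ∂(Measure.infinitePi fun _ : Ring G => fairCoin) =
        coinMean fun c => ∫ w', H (runRings l (w, w') (chameleonStep (p.1 : Sym2 V) s c M))
          ∂(Measure.infinitePi fun _ : Ring G => fairCoin) := fun w => by
      rw [integral_infinitePi_update p
        (fun w' => H (runRings (p :: l) (Function.update w p s, w') M))
        (hm.comp measurable_prodMk_left) fun _ => hC _]
      congr 1
      funext c
      exact integral_congr_ae (.of_forall fun w' => congrArg H (hstep (w, w') s c))
    simp only [hinner]
    rw [integral_coinMean fun c => (hint _ _).integral_prod_left]
    congr 1
    funext c
    rw [integral_prod _ (hint _ _)]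

end Law

/-! ### Measurability of the ring list and Fubini for the driving law. -/

section RingList

variable {V : Type*} [Fintype V] {G : SimpleGraph V}

/-- The driving randomness with given components. -/
def Driving.ofTuple (q : Placement V × (Ring G → ℝ) × (Ring G → Bool) × (Ring G → Bool)) :
    Driving G :=
  ⟨q.1, q.2.1, q.2.2.1, q.2.2.2⟩

theorem Driving.IsRingList.nodup {U : Driving G} {t : ℝ} {l : List (Ring G)}
    (h : U.IsRingList t l) : l.Nodup :=
  h.1.imp fun hlt heq => by simp [heq] at hlt

theorem Driving.IsRingList.unique {U : Driving G} {t : ℝ} {l l' : List (Ring G)}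
    (h : U.IsRingList t l) (h' : U.IsRingList t l') : l = l' :=
  ((List.perm_ext_iff_of_nodup h.nodup h'.nodup).2 fun p => (h.2 p).trans (h'.2 p).symm)
    |>.eq_of_pairwise (fun _ _ _ _ h1 h2 => absurd h1 h2.asymm) h.1 h'.1

theorem Driving.ringList_nodup (U : Driving G) (t : ℝ) : (U.ringList t).Nodup := by
  unfold Driving.ringList
  split_ifs with h
  · exact h.choose_spec.nodup
  · exact List.nodup_nil

/-- Uniqueness replaces the choice by an explicit condition, from which measurability can be read
off; the second case is the default value. -/
theorem Driving.ringList_eq_iff (U : Driving G) (t : ℝ) (l : List (Ring G)) :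
    U.ringList t = l ↔ U.IsRingList t l ∨ (l = [] ∧ ∀ l', ¬ U.IsRingList t l') := by
  unfold Driving.ringList
  split_ifs with h
  · constructor
    · rintro rfl; exact Or.inl h.choose_spec
    · rintro (h' | ⟨_, h'⟩)
      · exact h.choose_spec.unique h'
      · exact absurd h (by simpa using h')
  · push Not at h
    simp [h, eq_comm]

theorem measurableSet_isRingList (t : ℝ) (l : List (Ring G)) :
    MeasurableSet {q | (Driving.ofTuple q : Driving G).IsRingList t l} := by
  have hT : ∀ p : Ring G, Measurable fun q => (Driving.ofTuple q : Driving G).ringTime p :=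
    fun p => by
      simp only [Driving.ringTime, Driving.ofTuple]
      fun_prop
  have h1 : MeasurableSet {q | l.Pairwise fun p r : Ring G =>
      (Driving.ofTuple q : Driving G).ringTime p < (Driving.ofTuple q).ringTime r} := by
    induction l with
    | nil => simp
    | cons p l ih =>
      simp only [List.pairwise_cons, Set.ofPred_and, Set.ofPred_forall]
      exact (MeasurableSet.iInter fun r => MeasurableSet.iInter fun _ =>
        measurableSet_lt (hT p) (hT r)).inter ih
  have h2 : MeasurableSet {q | ∀ p : Ring G, p ∈ l ↔
      (Driving.ofTuple q : Driving G).ringTime p ≤ t} := by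
    simp only [Set.ofPred_forall]
    refine MeasurableSet.iInter fun p => ?_
    by_cases hp : p ∈ l
    · simpa [hp] using measurableSet_le (hT p) measurable_const
    · simpa [hp] using measurableSet_lt measurable_const (hT p)
  exact h1.inter h2

theorem measurableSet_ringList_eq (t : ℝ) (l : List (Ring G)) :
    MeasurableSet {q | (Driving.ofTuple q : Driving G).ringList t = l} := by
  simp only [Driving.ringList_eq_iff]
  have h : MeasurableSet {q | ∀ l', ¬ (Driving.ofTuple q : Driving G).IsRingList t l'} := by
    simp only [Set.ofPred_forall]
    exact MeasurableSet.iInter fun l' => (measurableSet_isRingList t l').compl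
  exact (measurableSet_isRingList t l).union ((MeasurableSet.const _).inter h)

instance Placement.instMeasurableSingletonClass : MeasurableSingletonClass (Placement V) :=
  ⟨fun _ => trivial⟩

instance drivingLaw.instIsProbabilityMeasure (ν : Measure (Placement V)) [IsProbabilityMeasure ν] :
    IsProbabilityMeasure (drivingLaw G ν) := by
  unfold drivingLaw; infer_instance

theorem abs_redness_le (u : V) (M : Config V) : |redness u M| ≤ 1 := by
  rw [redness_eq_colorWeight]
  cases M.col (M.pos.symm u) <;> norm_num [colorWeight]

variable [DecidableEq V]

theorem chameleon_eq_runRings (b : ℕ) (U : Driving G) (t : ℝ) :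
    chameleon b U t =
      runRings (U.ringList t) (U.switchCoin, U.depinkCoin) (startConfig b U.start) := rfl

theorem chameleon_pos (b : ℕ) (U : Driving G) (t : ℝ) :
    (chameleon b U t).pos = interchange U t := by
  unfold chameleon interchange
  suffices h : ∀ (l : List (Ring G)) (M : Config V),
      (l.foldl (fun M p => chameleonStep (p.1 : Sym2 V) (U.switchCoin p) (U.depinkCoin p) M) M).pos
        = l.foldl (fun x p => interchangeStep (p.1 : Sym2 V) (U.switchCoin p) x) M.pos from
    h _ _
  intro l
  induction l with
  | nil => exact fun _ => rfl
  | cons p l ih => exact fun M => by rw [List.foldl_cons, List.foldl_cons, ih, chameleonStep_pos]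

theorem measurable_chameleon (H : Config V → ℝ) (b : ℕ) (t : ℝ) :
    Measurable fun q => H (chameleon b (Driving.ofTuple q : Driving G) t) := by
  -- There are only countably many lists of rings, so the discrete σ-algebra suffices.
  let _ : MeasurableSpace (List (Ring G)) := ⊤
  have : MeasurableSingletonClass (List (Ring G)) := ⟨fun _ => trivial⟩
  have hlist : Measurable fun q => (Driving.ofTuple q : Driving G).ringList t :=
    measurable_to_countable' fun l => measurableSet_ringList_eq t l
  have h : Measurable fun r : (List (Ring G) × Placement V) ×
      ((Ring G → Bool) × (Ring G → Bool)) => H (runRings r.1.1 r.2 (startConfig b r.1.2)) :=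
    measurable_from_prod_countable_right fun lx =>
      measurable_runRings H lx.1 (startConfig b lx.2)
  simp only [chameleon_eq_runRings]
  have hcomp := h.comp ((hlist.prodMk measurable_fst).prodMk measurable_snd.snd)
  simp only [Function.comp_def] at hcomp
  exact hcomp

theorem measurableSet_chameleon (p : Config V → Prop) (b : ℕ) (t : ℝ) :
    MeasurableSet {q | p (chameleon b (Driving.ofTuple q : Driving G) t)} := by
  classical
  have h := measurable_chameleon (G := G) (fun M => if p M then 1 else 0) b t
    (measurableSet_singleton 1)
  convert h using 1
  ext q
  simp

theorem abs_redness_sub_placedInd_le {b : ℕ} (hb : b < Fintype.card V) (z : Fin (b + 1) → V)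
    (M : Config V) : |∑ j, colorWeight (M.col j) * placedInd hb z j M.pos -
      placedInd hb z ⟨b, hb⟩ M.pos| ≤ 2 := by
  classical
  rw [sum_colorWeight_mul_placedInd]
  refine (abs_sub _ _).trans ?_
  have h1 := abs_redness_le (z (Fin.last b)) M
  unfold placedInd
  split_ifs <;> norm_num <;> linarith

/-- With placement and waiting times frozen, the inner coin integral already vanishes. This holds
for every ring list, also the default `[]`, so no null event has to be discarded. -/
theorem integral_drivingLaw_eq_zero (ν : Measure (Placement V)) [IsProbabilityMeasure ν]
    (H : Config V → ℝ) {C : ℝ} (hC : ∀ M, |H M| ≤ C) (b : ℕ) (t : ℝ)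
    (h : ∀ l x, chameleonMean H l (startConfig b x) = 0) :
    ∫ q, H (chameleon b (Driving.ofTuple q) t) ∂(drivingLaw G ν) = 0 := by
  have hm := measurable_chameleon (G := G) H b t
  unfold drivingLaw
  rw [integral_prod _ (.of_bound hm.aestronglyMeasurable C (.of_forall fun _ => hC _))]
  refine integral_eq_zero_of_ae (.of_forall fun x => ?_)
  have hx := hm.comp (measurable_prodMk_left (x := x))
  simp only [Function.comp_def] at hx
  dsimp only
  rw [integral_prod _ (.of_bound hx.aestronglyMeasurable C (.of_forall fun _ => hC _))]
  refine integral_eq_zero_of_ae (.of_forall fun w => ?_)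
  -- The ring list depends on the waiting times alone; the constant coins are placeholders.
  have hl := (Driving.ofTuple (x, w, fun _ => false, fun _ => false) : Driving G).ringList_nodup t
  exact (integral_runRings H hC hl (startConfig b x)).trans (h _ _)

end RingList

end Chameleon

end

/-! ### Passage to the conditional law. -/

theorem lemma1 {V : Type*} [Fintype V] [DecidableEq V] (G : SimpleGraph V)
    {Ω : Type*} [MeasurableSpace Ω] (P : Measure Ω)
    (ν : Measure (Chameleon.Placement V)) [IsProbabilityMeasure ν]
    (U : Ω → Chameleon.Driving G)
    (hU : HasLaw (fun ω => (U ω).toTuple) (Chameleon.drivingLaw G ν) P)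
    (b : ℕ) (hb : b < Fintype.card V)
    (z : Fin (b + 1) → V) (hz : Function.Injective z) (t : ℝ) (ht : 0 ≤ t) :
    Integrable (fun ω => Chameleon.redness (z (Fin.last b)) (Chameleon.chameleon b (U ω) t)) P ∧
    (ProbabilityTheory.cond P
        {ω | ∀ i : Fin b,
          Chameleon.interchange (U ω) t ⟨i, i.isLt.trans hb⟩ = z i.castSucc}).real
      {ω | Chameleon.interchange (U ω) t ⟨b, hb⟩ = z (Fin.last b)} =
    ∫ ω, Chameleon.redness (z (Fin.last b)) (Chameleon.chameleon b (U ω) t)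
      ∂(ProbabilityTheory.cond P
        {ω | ∀ i : Fin b,
          (Chameleon.chameleon b (U ω) t).pos ⟨i, i.isLt.trans hb⟩ = z i.castSucc}) := by
  classical
  have hP : IsProbabilityMeasure P := hU.isProbabilityMeasure
  have hint : ∀ (H : Chameleon.Config V → ℝ) (C : ℝ), (∀ M, |H M| ≤ C) →
      Integrable (fun ω => H (Chameleon.chameleon b (U ω) t)) P := fun H C hC =>
    .of_bound ((Chameleon.measurable_chameleon (G := G) H b t).comp_aemeasurable
      hU.aemeasurable).aestronglyMeasurable C (.of_forall fun _ => hC _)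
  -- `hU` gives only a.e. measurability, so events are null measurable.
  have hnull : ∀ p : Chameleon.Config V → Prop,
      NullMeasurableSet {ω | p (Chameleon.chameleon b (U ω) t)} P := fun p =>
    hU.aemeasurable.nullMeasurable (Chameleon.measurableSet_chameleon (G := G) p b t)
  have hred := hint _ 1 (Chameleon.abs_redness_le (z (Fin.last b)))
  refine ⟨hred, ?_⟩
  simp only [← Chameleon.chameleon_pos b]
  set A := {ω | ∀ i : Fin b,
    (Chameleon.chameleon b (U ω) t).pos ⟨i, i.isLt.trans hb⟩ = z i.castSucc} with hA
  set B := {ω | (Chameleon.chameleon b (U ω) t).pos ⟨b, hb⟩ = z (Fin.last b)} with hB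
  have hAm : NullMeasurableSet A P :=
    hnull fun M => ∀ i : Fin b, M.pos ⟨i, i.isLt.trans hb⟩ = z i.castSucc
  have hBm : NullMeasurableSet B P := hnull fun M => M.pos ⟨b, hb⟩ = z (Fin.last b)
  have hzero := Chameleon.integral_drivingLaw_eq_zero (G := G) ν _
    (Chameleon.abs_redness_sub_placedInd_le hb z) b t (Chameleon.chameleonMean_startConfig hb z)
  rw [← hU.integral_comp (Chameleon.measurable_chameleon (G := G) (fun M =>
      ∑ j, Chameleon.colorWeight (M.col j) * Chameleon.placedInd hb z j M.pos -
        Chameleon.placedInd hb z ⟨b, hb⟩ M.pos) b t).aestronglyMeasurable] at hzero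
  have hind : ∀ ω, (∑ j, Chameleon.colorWeight ((Chameleon.chameleon b (U ω) t).col j) *
      Chameleon.placedInd hb z j (Chameleon.chameleon b (U ω) t).pos -
      Chameleon.placedInd hb z ⟨b, hb⟩ (Chameleon.chameleon b (U ω) t).pos) =
      A.indicator (fun ω => Chameleon.redness (z (Fin.last b)) (Chameleon.chameleon b (U ω) t)) ω -
        (A ∩ B).indicator (fun _ => (1 : ℝ)) ω := fun ω => by
    rw [Chameleon.sum_colorWeight_mul_placedInd, Set.indicator_apply, Set.indicator_apply]
    have hABω : ω ∈ A ∩ B ↔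
        Chameleon.placedAt hb z ⟨b, hb⟩ (Chameleon.chameleon b (U ω) t).pos := Iff.rfl
    unfold Chameleon.placedInd
    congr 1
    simp only [hABω]
  have hzero' : ∫ ω, (A.indicator (fun ω => Chameleon.redness (z (Fin.last b))
      (Chameleon.chameleon b (U ω) t)) ω - (A ∩ B).indicator (fun _ => (1 : ℝ)) ω) ∂P = 0 := by
    simp only [← hind]
    exact hzero
  rw [integral_sub (hred.indicator₀ hAm) ((integrable_const _).indicator₀ (hAm.inter hBm)),
    integral_indicator₀ hAm, integral_indicator₀ (hAm.inter hBm), setIntegral_const, sub_eq_zero]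
    at hzero'
  -- Both sides carry the same factor `((P A)⁻¹).toReal`, so `P A = 0` needs no separate treatment.
  rw [ProbabilityTheory.cond, integral_smul_measure, hzero', measureReal_ennreal_smul_apply,
    measureReal_def (P.restrict A), Measure.restrict_apply₀' hAm, Set.inter_comm]
  simp [measureReal_def]
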